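/- Let $X$ be a real Banach space and let $(\Omega,\Sigma,\mu)$ be a complete probability space. Let $L_\infty(\mu,X)$ be the Banach space of (classes modulo $\mu$-a.e. equality of) strongly $\mu$-measurable, essentially bounded functions $f:\Omega\to X$, with the norm $\|f\|_\infty=\operatorname{ess\,sup}_{s\in\Omega}\|f(s)\|$. Let $W\subset X$ be a nonempty weakly compact set, and put $$L_\infty(\mu,W)=\{g\in L_\infty(\mu,X): g(s)\in W \text{ for a.e. } s\in\Omega\}.$$ Let $n$ be a positive integer and let $N$ be a monotonous norm on $\mathbb{R}^n$, that is, a norm such that $N(t)\le N(s)$ whenever $t,s\in\mathbb{R}^n$ satisfy $|t_i|\le|s_i|$ for $i=1,\dots,n$. Then $L_\infty(\mu,W)$ is $N$-simultaneously proximinal in $L_\infty(\mu,X)$: for all $f_1,\dots,f_n\in L_\infty(\mu,X)$ there exists $g_0\in L_\infty(\mu,W)$ such that $$N\big(\|f_1-g_0\|_\infty,\dots,\|f_n-g_0\|_\infty\big)\le N\big(\|f_1-g\|_\infty,\dots,\|f_n-g\|_\infty\big)\quad\text{for every } g\in L_\infty(\mu,W).$$ -/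

import Mathlib

open MeasureTheory
open scoped ENNReal

/-- `N` is a norm on `ℝⁿ` (a seminorm that vanishes only at `0`) which is monotonous:
`|tᵢ| ≤ |sᵢ|` for all `i` implies `N t ≤ N s`. -/
structure IsMonotonousNorm {n : ℕ} (N : Seminorm ℝ (Fin n → ℝ)) : Prop where
  eq_zero_of_apply_eq_zero : ∀ t : Fin n → ℝ, N t = 0 → t = 0
  monotonous : ∀ t s : Fin n → ℝ, (∀ i, |t i| ≤ |s i|) → N t ≤ N s

/-- `y₀` is a best `N`-simultaneous approximation from `Y` of the vectors `x₁, …, xₙ`. -/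
def IsBestSimultaneousApprox {E : Type*} [NormedAddCommGroup E] {n : ℕ}
    (N : Seminorm ℝ (Fin n → ℝ)) (Y : Set E) (x : Fin n → E) (y₀ : E) : Prop :=
  y₀ ∈ Y ∧ ∀ y ∈ Y, N (fun i => ‖x i - y₀‖) ≤ N (fun i => ‖x i - y‖)

/-- `Y` is `N`-simultaneously proximinal in `E`: every `n`-tuple of vectors of `E` admits a best
`N`-simultaneous approximation from `Y`. -/
def IsSimultaneouslyProximinal {E : Type*} [NormedAddCommGroup E] {n : ℕ}
    (N : Seminorm ℝ (Fin n → ℝ)) (Y : Set E) : Prop :=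
  ∀ x : Fin n → E, ∃ y₀ : E, IsBestSimultaneousApprox N Y x y₀

/-- `W` is compact in the weak topology of `X`. -/
def IsWeaklyCompact {X : Type*} [NormedAddCommGroup X] [NormedSpace ℝ X] (W : Set X) : Prop :=
  IsCompact (toWeakSpace ℝ X '' W)

/-- `L_∞(μ, W)`: the elements `g` of `L_∞(μ, X)` with `g(s) ∈ W` for almost every `s`. -/
def LInftyInto {Ω : Type*} [MeasurableSpace Ω] (μ : Measure Ω)
    {X : Type*} [NormedAddCommGroup X] (W : Set X) : Set (Lp X ∞ μ) :=
  {g | ∀ᵐ s ∂μ, g s ∈ W}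

open Filter Topology

/-- Measurable selection of a cluster point of a sequence of measurable maps into a compact metric
space. -/
theorem exists_measurable_forall_mapClusterPt {K Ω : Type*} [MetricSpace K] [CompactSpace K]
    [Nonempty K] [MeasurableSpace K] [BorelSpace K] [MeasurableSpace Ω] (u : ℕ → Ω → K)
    (hu : ∀ k, Measurable (u k)) :
    ∃ v : Ω → K, Measurable v ∧ ∀ s, MapClusterPt (v s) atTop (fun k => u k s) := by
  obtain ⟨σ', hσ'c, hσ's⟩ := exists_nat_bool_continuous_surjective_of_compact K
  let σ : cantorSet → K := σ' ∘ cantorSetHomeomorphNatToBool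
  have hσ : Continuous σ := hσ'c.comp cantorSetHomeomorphNatToBool.continuous
  have hσs : Function.Surjective σ := hσ's.comp cantorSetHomeomorphNatToBool.surjective
  have : CompactSpace cantorSet := isCompact_iff_compactSpace.1 isCompact_cantorSet
  let C : Ω → Set cantorSet := fun s => {t | MapClusterPt (σ t) atTop (fun k => u k s)}
  have hC : ∀ s, IsCompact (C s) := fun s =>
    (isClosed_setOfPred_clusterPt.preimage hσ).isCompact
  have hCne : ∀ s, (C s).Nonempty := fun s => by
    obtain ⟨x, -, hx⟩ := (isCompact_univ (X := K)).exists_mapClusterPt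
      (f := atTop) (u := fun k => u k s) (by simp)
    obtain ⟨t, rfl⟩ := hσs x
    exact ⟨t, hx⟩
  choose τ hτC hτ using fun s =>
    (hC s).exists_isMinOn (hCne s) (f := fun t : cantorSet => (t : ℝ)) (by fun_prop)
  refine ⟨fun s => σ (τ s), hσ.measurable.comp ?_, hτC⟩
  suffices h : Measurable (fun s => (τ s : ℝ)) from h.subtype_mk
  refine measurable_of_Iic fun a => ?_
  set F : Set K := σ '' {t | (t : ℝ) ≤ a}
  have hFc : IsClosed F :=
    ((isClosed_le (by fun_prop) continuous_const).isCompact.image hσ).isClosed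
  rcases F.eq_empty_or_nonempty with hFe | hFne
  · convert MeasurableSet.empty
    refine Set.eq_empty_of_forall_notMem fun s hs => ?_
    have : σ (τ s) ∈ F := ⟨τ s, hs, rfl⟩
    simp [hFe] at this
  have key : (fun s => (τ s : ℝ)) ⁻¹' Set.Iic a =
      ⋂ m : ℕ, ⋂ j : ℕ, ⋃ k ≥ j, {s | Metric.infDist (u k s) F < 1 / ((m : ℝ) + 1)} := by
    ext s
    have hiff : s ∈ (⋂ m : ℕ, ⋂ j : ℕ, ⋃ k ≥ j,
        {s | Metric.infDist (u k s) F < 1 / ((m : ℝ) + 1)}) ↔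
        ∀ m : ℕ, ∃ᶠ k in atTop, Metric.infDist (u k s) F < 1 / ((m : ℝ) + 1) := by
      simp [frequently_atTop]
    rw [hiff]
    constructor
    · intro hs m
      have hmem : σ (τ s) ∈ F := ⟨τ s, hs, rfl⟩
      refine (hτC s : MapClusterPt _ _ _).frequently
        (p := fun x => Metric.infDist x F < 1 / ((m : ℝ) + 1)) ?_
      refine (Metric.continuous_infDist_pt F).continuousAt.eventually_lt_const ?_
      simpa only [Metric.infDist_zero_of_mem hmem] using Nat.one_div_pos_of_nat
    · intro h
      obtain ⟨φ, hφ, hlt⟩ := extraction_forall_of_frequently h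
      obtain ⟨x, ψ, hψ, hx⟩ := CompactSpace.tendsto_subseq (fun k => u (φ k) s)
      have h0 : Metric.infDist x F ≤ 0 := by
        refine le_of_tendsto_of_tendsto
          (((Metric.continuous_infDist_pt F).tendsto x).comp hx)
          (tendsto_one_div_add_atTop_nhds_zero_nat.comp hψ.tendsto_atTop)
          (Eventually.of_forall fun k => (hlt (ψ k)).le)
      obtain ⟨t, hta, rfl⟩ := (hFc.mem_iff_infDist_zero hFne).2
        (le_antisymm h0 Metric.infDist_nonneg)
      have : t ∈ C s := hx.mapClusterPt.of_comp (hφ.comp hψ).tendsto_atTop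
      exact (show (τ s : ℝ) ≤ t from hτ s this).trans (show (t : ℝ) ≤ a from hta)
  rw [key]
  refine MeasurableSet.iInter fun m => MeasurableSet.iInter fun j =>
    MeasurableSet.iUnion fun k => MeasurableSet.iUnion fun _ => ?_
  exact measurableSet_lt ((Metric.continuous_infDist_pt F).measurable.comp (hu k))
    measurable_const

/-- A function with separable range is strongly measurable as soon as the preimages of the closed
balls are measurable. -/
theorem stronglyMeasurable_of_measurableSet_preimage_closedBall {Ω X : Type*} [MeasurableSpace Ω]
    [PseudoMetricSpace X] {g : Ω → X} {Y : Set X} (hY : TopologicalSpace.IsSeparable Y)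
    (hgY : ∀ s, g s ∈ Y) (hg : ∀ x r, MeasurableSet (g ⁻¹' Metric.closedBall x r)) :
    StronglyMeasurable g := by
  borelize X
  refine stronglyMeasurable_iff_measurable_separable.2
    ⟨measurable_of_isOpen fun U hU => ?_, hY.mono (Set.range_subset_iff.2 hgY)⟩
  obtain ⟨D, hD, hYD⟩ := hY
  have key : g ⁻¹' U = ⋃ d ∈ D, ⋃ m : ℕ,
      ⋃ _ : Metric.closedBall d (1 / ((m : ℝ) + 1)) ⊆ U,
        g ⁻¹' Metric.closedBall d (1 / ((m : ℝ) + 1)) := by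
    ext s
    simp only [Set.mem_iUnion, Set.mem_preimage, exists_prop]
    constructor
    · intro hs
      obtain ⟨ε, hε, hεU⟩ := Metric.isOpen_iff.1 hU _ hs
      obtain ⟨m, hm⟩ := exists_nat_one_div_lt (half_pos hε)
      obtain ⟨d, hd, hdist⟩ := Metric.mem_closure_iff.1 (hYD (hgY s)) (1 / ((m : ℝ) + 1))
        (by positivity)
      refine ⟨d, hd, m, fun y hy => hεU ?_, hdist.le⟩
      rw [Metric.mem_closedBall] at hy
      rw [Metric.mem_ball]
      have := dist_triangle y d (g s)
      rw [dist_comm d] at this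
      linarith
    · rintro ⟨d, -, m, hsub, hs⟩
      exact hsub hs
  rw [key]
  exact MeasurableSet.biUnion hD fun d _ => MeasurableSet.iUnion fun m =>
    MeasurableSet.iUnion fun _ => hg _ _

theorem IsClosed.toWeakSpace_image {X : Type*} [NormedAddCommGroup X] [NormedSpace ℝ X]
    {s : Set X} (hs : IsClosed s) (hc : Convex ℝ s) : IsClosed (toWeakSpace ℝ X '' s) := by
  rw [← closure_eq_iff_isClosed, ← hc.toWeakSpace_closure ℝ, hs.closure_eq]

/-- A separable set in a normed space has a countable family of continuous functionals separating
its points from zero. -/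
theorem exists_seq_strongDual_ne_zero {X : Type*} [NormedAddCommGroup X] [NormedSpace ℝ X]
    {Y : Set X} (hY : TopologicalSpace.IsSeparable Y) :
    ∃ φ : ℕ → StrongDual ℝ X, ∀ x ∈ Y, x ≠ 0 → ∃ j, φ j x ≠ 0 := by
  obtain ⟨D, hD, hYD⟩ := hY
  rcases D.eq_empty_or_nonempty with rfl | hne
  · refine ⟨0, fun x hx => ?_⟩
    simpa using hYD hx
  obtain ⟨d, rfl⟩ := hD.exists_eq_range hne
  choose φ hφ1 hφ using fun j => exists_dual_vector'' ℝ (d j)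
  refine ⟨φ, fun x hx hx0 => ?_⟩
  obtain ⟨_, ⟨j, rfl⟩, hj⟩ := Metric.mem_closure_iff.1 (hYD hx) (‖x‖ / 2)
    (half_pos (norm_pos_iff.2 hx0))
  refine ⟨j, fun h0 => ?_⟩
  have h1 : φ j (d j) = ‖d j‖ := hφ j
  have h2 : ‖φ j (d j - x)‖ ≤ ‖d j - x‖ := by
    simpa using (φ j).le_of_opNorm_le (hφ1 j) (d j - x)
  rw [map_sub, h0, sub_zero, h1, norm_norm] at h2
  rw [dist_eq_norm, norm_sub_rev] at hj
  have := norm_sub_norm_le x (d j)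
  rw [norm_sub_rev] at this
  linarith

/-- A weakly compact set contained in a separable subspace is weakly metrizable. -/
theorem IsWeaklyCompact.metrizableSpace {X : Type*} [NormedAddCommGroup X] [NormedSpace ℝ X]
    {W : Set X} (hW : IsWeaklyCompact W) {Y : Submodule ℝ X}
    (hY : TopologicalSpace.IsSeparable (Y : Set X)) (hWY : W ⊆ Y) :
    TopologicalSpace.MetrizableSpace (toWeakSpace ℝ X '' W) := by
  obtain ⟨φ, hφ⟩ := exists_seq_strongDual_ne_zero hY
  have : CompactSpace (toWeakSpace ℝ X '' W) := isCompact_iff_compactSpace.1 hW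
  refine Metric.PiNatEmbed.TopologicalSpace.MetrizableSpace.of_countable_separating
    (fun j (x : toWeakSpace ℝ X '' W) => φ j ((toWeakSpace ℝ X).symm x.1)) (fun j => ?_) ?_
  · exact (WeakBilin.eval_continuous (topDualPairing ℝ X).flip (φ j)).comp continuous_subtype_val
  · rintro ⟨_, x, hx, rfl⟩ ⟨_, y, hy, rfl⟩ hxy
    have hne : x - y ≠ 0 := fun h => hxy (by simp [sub_eq_zero.1 h])
    obtain ⟨j, hj⟩ := hφ (x - y) (Y.sub_mem (hWY hx) (hWY hy)) hne
    refine ⟨j, fun h => hj ?_⟩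
    rw [map_sub, sub_eq_zero]
    simpa using h

/-- A sequence of strongly measurable functions with values in a weakly compact set has a strongly
measurable selection of weak cluster points. -/
theorem IsWeaklyCompact.exists_stronglyMeasurable_mapClusterPt {X Ω : Type*}
    [NormedAddCommGroup X] [NormedSpace ℝ X] [MeasurableSpace Ω] {W : Set X}
    (hW : IsWeaklyCompact W) (hWne : W.Nonempty) (u : ℕ → Ω → X)
    (hu : ∀ k, StronglyMeasurable (u k)) (huW : ∀ k s, u k s ∈ W) :
    ∃ v : Ω → X, StronglyMeasurable v ∧ (∀ s, v s ∈ W) ∧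
      ∀ s, MapClusterPt (toWeakSpace ℝ X (v s)) atTop (fun k => toWeakSpace ℝ X (u k s)) := by
  obtain ⟨w, hw⟩ := hWne
  let Y : Submodule ℝ X :=
    (Submodule.span ℝ (insert w (⋃ k, Set.range (u k)))).topologicalClosure
  have hsub : insert w (⋃ k, Set.range (u k)) ⊆ (Y : Set X) :=
    Submodule.subset_span.trans (Submodule.le_topologicalClosure _)
  have hY : TopologicalSpace.IsSeparable (Y : Set X) := by
    refine TopologicalSpace.IsSeparable.closure (TopologicalSpace.IsSeparable.span ?_)
    rw [Set.insert_eq]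
    exact (Set.finite_singleton w).isSeparable.union
      (TopologicalSpace.IsSeparable.iUnion fun k => (hu k).isSeparable_range)
  have hK : IsWeaklyCompact (W ∩ Y) := by
    rw [IsWeaklyCompact, Set.image_inter (toWeakSpace ℝ X).injective]
    exact hW.inter_right
      ((Submodule.isClosed_topologicalClosure _).toWeakSpace_image Y.convex)
  let K := toWeakSpace ℝ X '' (W ∩ Y)
  have : CompactSpace K := isCompact_iff_compactSpace.1 hK
  have : TopologicalSpace.MetrizableSpace K := hK.metrizableSpace hY Set.inter_subset_right
  let _ := TopologicalSpace.metrizableSpaceMetric K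
  have : Nonempty K := ⟨⟨_, w, ⟨hw, hsub (Set.mem_insert _ _)⟩, rfl⟩⟩
  let _ : MeasurableSpace K := borel K
  have : BorelSpace K := ⟨rfl⟩
  borelize X
  have huY : ∀ k s, u k s ∈ W ∩ (Y : Set X) := fun k s =>
    ⟨huW k s, hsub (Set.mem_insert_of_mem _ (Set.mem_iUnion.2 ⟨k, s, rfl⟩))⟩
  have hcont : Continuous (toWeakSpace ℝ X) := (toWeakSpaceCLM ℝ X).continuous
  let u' : ℕ → Ω → K := fun k s => ⟨toWeakSpace ℝ X (u k s), u k s, huY k s, rfl⟩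
  have hu' : ∀ k, Measurable (u' k) := fun k => by
    refine measurable_of_isOpen fun U hU => ?_
    obtain ⟨V, hV, rfl⟩ := isOpen_induced_iff.1 hU
    exact (hu k).measurable (hV.preimage hcont).measurableSet
  obtain ⟨v, hv, hvc⟩ := exists_measurable_forall_mapClusterPt u' hu'
  have hvW : ∀ s, (toWeakSpace ℝ X).symm (v s) ∈ W ∩ (Y : Set X) := fun s => by
    obtain ⟨x, hx, hxs⟩ := (v s).2
    rw [← hxs]
    simpa using hx
  refine ⟨fun s => (toWeakSpace ℝ X).symm (v s), ?_, fun s => (hvW s).1, fun s => ?_⟩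
  · refine stronglyMeasurable_of_measurableSet_preimage_closedBall hY (fun s => (hvW s).2)
      fun x r => ?_
    have hcl := (Metric.isClosed_closedBall (x := x) (ε := r)).toWeakSpace_image
      (convex_closedBall x r)
    have := hv (hcl.preimage (continuous_subtype_val (p := (· ∈ K)))).measurableSet
    convert this using 1
    ext s
    simp [LinearEquiv.image_eq_preimage_symm]
  · simp only [LinearEquiv.apply_symm_apply]
    have h := (hvc s).tendsto_comp (continuous_subtype_val.tendsto (v s))
    exact h

theorem IsWeaklyCompact.isClosed {X : Type*} [NormedAddCommGroup X] [NormedSpace ℝ X]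
    {W : Set X} (hW : IsWeaklyCompact W) : IsClosed W := by
  have h : IsClosed (toWeakSpace ℝ X '' W) := IsCompact.isClosed hW
  have h' : IsClosed (toWeakSpace ℝ X ⁻¹' (toWeakSpace ℝ X '' W)) :=
    h.preimage (toWeakSpaceCLM ℝ X).continuous
  rwa [Set.preimage_image_eq _ (toWeakSpace ℝ X).injective] at h'

theorem norm_sub_le_of_mapClusterPt_toWeakSpace {X : Type*} [NormedAddCommGroup X]
    [NormedSpace ℝ X] {u : ℕ → X} {v y : X} {d : ℕ → ℝ} {r : ℝ}
    (hv : MapClusterPt (toWeakSpace ℝ X v) atTop (fun k => toWeakSpace ℝ X (u k)))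
    (hd : Tendsto d atTop (𝓝 r)) (hu : ∀ k, ‖y - u k‖ ≤ d k) : ‖y - v‖ ≤ r := by
  refine le_of_forall_pos_le_add fun ε hε => ?_
  have hcl := (Metric.isClosed_closedBall (x := y) (ε := r + ε)).toWeakSpace_image
    (convex_closedBall y (r + ε))
  have hev : ∀ᶠ k in atTop, toWeakSpace ℝ X (u k) ∈
      toWeakSpace ℝ X '' Metric.closedBall y (r + ε) := by
    filter_upwards [hd.eventually_le_const (lt_add_of_pos_right r hε)] with k hk
    refine ⟨u k, ?_, rfl⟩
    rw [mem_closedBall_iff_norm']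
    exact (hu k).trans hk
  obtain ⟨z, hz, hzv⟩ := hcl.mem_of_mapClusterPt hv hev
  rw [← (toWeakSpace ℝ X).injective hzv]
  exact mem_closedBall_iff_norm'.1 hz

theorem ae_norm_le_norm_Lp_top {X Ω : Type*} [NormedAddCommGroup X] [MeasurableSpace Ω]
    {μ : Measure Ω} (f : Lp X ∞ μ) : ∀ᵐ s ∂μ, ‖f s‖ ≤ ‖f‖ := by
  rw [Lp.norm_def, toReal_eLpNorm (Lp.aestronglyMeasurable f)]
  exact ae_le_lpNorm_exponent_top (Lp.memLp f)

/-- An almost everywhere `W`-valued essentially bounded function agrees almost everywhere with a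
strongly measurable `W`-valued function. -/
theorem exists_stronglyMeasurable_forall_mem_of_mem_LInftyInto {X Ω : Type*}
    [NormedAddCommGroup X] [MeasurableSpace Ω] {μ : Measure Ω} {W : Set X} (hW : IsClosed W)
    (hWne : W.Nonempty) {g : Lp X ∞ μ} (hg : g ∈ LInftyInto μ W) :
    ∃ u : Ω → X, StronglyMeasurable u ∧ (∀ s, u s ∈ W) ∧ u =ᵐ[μ] g := by
  classical
  obtain ⟨w, hw⟩ := hWne
  borelize X
  refine ⟨fun s => if g s ∈ W then g s else w,
    StronglyMeasurable.ite ((Lp.stronglyMeasurable g).measurable hW.measurableSet)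
      (Lp.stronglyMeasurable g) stronglyMeasurable_const, fun s => ?_, ?_⟩
  · dsimp only
    split_ifs with h
    exacts [h, hw]
  · filter_upwards [show ∀ᵐ s ∂μ, g s ∈ W from hg] with s hs
    simp [hs]

/-- Limits of distances to a sequence in `L_∞(μ, W)` bound the distances to some element of
`L_∞(μ, W)`. -/
theorem exists_mem_LInftyInto_norm_sub_le {X Ω ι : Type*} [NormedAddCommGroup X] [NormedSpace ℝ X]
    [MeasurableSpace Ω] {μ : Measure Ω} [IsProbabilityMeasure μ] {W : Set X}
    (hWne : W.Nonempty) (hW : IsWeaklyCompact W) [Finite ι] [Nonempty ι] (f : ι → Lp X ∞ μ)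
    (g : ℕ → Lp X ∞ μ) (hg : ∀ k, g k ∈ LInftyInto μ W) (r : ι → ℝ)
    (hr : ∀ i, Tendsto (fun k => ‖f i - g k‖) atTop (𝓝 (r i))) :
    ∃ g₀ ∈ LInftyInto μ W, ∀ i, ‖f i - g₀‖ ≤ r i := by
  choose u hu huW hug using fun k =>
    exists_stronglyMeasurable_forall_mem_of_mem_LInftyInto hW.isClosed hWne (hg k)
  obtain ⟨v, hv, hvW, hvc⟩ := hW.exists_stronglyMeasurable_mapClusterPt hWne u hu huW
  have hbound : ∀ i, ∀ᵐ s ∂μ, ‖f i s - v s‖ ≤ r i := fun i => by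
    have h : ∀ᵐ s ∂μ, ∀ k, ‖f i s - u k s‖ ≤ ‖f i - g k‖ := ae_all_iff.2 fun k => by
      filter_upwards [hug k, ae_norm_le_norm_Lp_top (f i - g k), Lp.coeFn_sub (f i) (g k)]
        with s h1 h2 h3
      rwa [h1, ← Pi.sub_apply, ← h3]
    filter_upwards [h] with s hs
    exact norm_sub_le_of_mapClusterPt_toWeakSpace (hvc s) (hr i) hs
  obtain ⟨i₀⟩ := ‹Nonempty ι›
  have hmem : MemLp v ∞ μ := by
    refine memLp_top_of_bound hv.aestronglyMeasurable (‖f i₀‖ + r i₀) ?_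
    filter_upwards [hbound i₀, ae_norm_le_norm_Lp_top (f i₀)] with s h1 h2
    have := norm_sub_norm_le (v s) (f i₀ s)
    rw [norm_sub_rev] at this
    linarith
  refine ⟨hmem.toLp v, ?_, fun i => ?_⟩
  · filter_upwards [hmem.coeFn_toLp] with s hs
    rw [hs]
    exact hvW s
  · have h0 : 0 ≤ r i := ge_of_tendsto' (hr i) fun k => norm_nonneg _
    have := Lp.norm_le_of_ae_bound (f := f i - hmem.toLp v) h0 (by
      filter_upwards [hbound i, hmem.coeFn_toLp, Lp.coeFn_sub (f i) (hmem.toLp v)] with s h1 h2 h3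
      rwa [h3, Pi.sub_apply, h2])
    simpa using this

theorem IsMonotonousNorm.pos {n : ℕ} {N : Seminorm ℝ (Fin n → ℝ)} (hN : IsMonotonousNorm N)
    {t : Fin n → ℝ} (ht : t ≠ 0) : 0 < N t :=
  (apply_nonneg N t).lt_of_ne fun h => ht (hN.eq_zero_of_apply_eq_zero t h.symm)

theorem IsMonotonousNorm.isBounded_setOf_le {n : ℕ} {N : Seminorm ℝ (Fin n → ℝ)}
    (hN : IsMonotonousNorm N) (c : ℝ) : Bornology.IsBounded {t | N t ≤ c} := by
  refine Bornology.forall_isBounded_image_eval_iff.1 fun i => ?_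
  have hi : 0 < N (Pi.single i 1) := hN.pos (by simp)
  refine isBounded_iff_forall_norm_le.2 ⟨c / N (Pi.single i 1), ?_⟩
  rintro _ ⟨t, ht, rfl⟩
  rw [le_div_iff₀ hi, Function.eval, ← map_smul_eq_mul]
  refine (hN.monotonous _ t fun j => ?_).trans ht
  rcases eq_or_ne j i with rfl | hj
  · simp
  · simp [hj]

theorem Seminorm.continuous_of_finiteDimensional {E : Type*} [NormedAddCommGroup E]
    [NormedSpace ℝ E] [FiniteDimensional ℝ E] (N : Seminorm ℝ E) : Continuous N :=
  continuousOn_univ.1 (N.convexOn.continuousOn isOpen_univ)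

theorem const_mem_LInftyInto {X Ω : Type*} [NormedAddCommGroup X] [MeasurableSpace Ω]
    {μ : Measure Ω} [IsFiniteMeasure μ] {W : Set X} {w : X} (hw : w ∈ W) :
    (memLp_const w).toLp (fun _ => w) ∈ LInftyInto μ W := by
  filter_upwards [(memLp_const (p := ∞) (μ := μ) w).coeFn_toLp] with s hs
  rwa [hs]

theorem mainTheorem1 {X : Type*} [NormedAddCommGroup X] [NormedSpace ℝ X] [CompleteSpace X]
    {Ω : Type*} [MeasurableSpace Ω] (μ : Measure Ω) [IsProbabilityMeasure μ] [μ.IsComplete]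
    (W : Set X) (hWne : W.Nonempty) (hW : IsWeaklyCompact W)
    (n : ℕ) (hn : 0 < n) (N : Seminorm ℝ (Fin n → ℝ)) (hN : IsMonotonousNorm N) :
    IsSimultaneouslyProximinal N (LInftyInto μ W) := by
  intro f
  have : Nonempty (Fin n) := ⟨⟨0, hn⟩⟩
  let Φ : Lp X ∞ μ → ℝ := fun g => N fun i => ‖f i - g‖
  obtain ⟨w, hw⟩ := hWne
  have hbdd : BddBelow (Φ '' LInftyInto μ W) := ⟨0, by
    rintro _ ⟨g, -, rfl⟩
    exact apply_nonneg N _⟩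
  obtain ⟨c, -, hc, hcmem⟩ := exists_seq_tendsto_sInf
    (Set.Nonempty.image Φ ⟨_, const_mem_LInftyInto hw⟩) hbdd
  choose g hg hgc using hcmem
  obtain ⟨C, hC⟩ := hc.bddAbove_range
  obtain ⟨r, -, φ, hφ, hr⟩ := tendsto_subseq_of_bounded (hN.isBounded_setOf_le C)
    (x := fun k i => ‖f i - g k‖) fun k => (hgc k).trans_le (hC ⟨k, rfl⟩)
  have hNr : N r = sInf (Φ '' LInftyInto μ W) := by
    refine tendsto_nhds_unique ((N.continuous_of_finiteDimensional.tendsto r).comp hr) ?_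
    refine (hc.comp hφ.tendsto_atTop).congr fun k => ?_
    exact (hgc (φ k)).symm
  obtain ⟨g₀, hg₀, hle⟩ := exists_mem_LInftyInto_norm_sub_le ⟨w, hw⟩ hW f (g ∘ φ)
    (fun k => hg (φ k)) r (tendsto_pi_nhds.1 hr)
  refine ⟨g₀, hg₀, fun y hy => ?_⟩
  calc N (fun i => ‖f i - g₀‖) ≤ N r := hN.monotonous _ _ fun i => by
        rw [abs_norm]
        exact (hle i).trans (le_abs_self _)
    _ ≤ Φ y := hNr.trans_le (csInf_le hbdd ⟨y, hy, rfl⟩)
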